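/- Let $k\ge 1$, $s\ge 2$ and $n\ge k+1$ be integers. A linear forest is a graph all of whose connected components are paths or isolated vertices; let $\mathcal{L}_{n,k}$ be the family of all linear forests with $n$ vertices and exactly $k$ edges. A graph is $\mathcal{L}_{n,k}$-free if none of its (not necessarily induced) subgraphs is isomorphic to a member of $\mathcal{L}_{n,k}$. Let $ex(n,K_s,\mathcal{L}_{n,k})$ be the maximum number of subgraphs isomorphic to $K_s$ in an $\mathcal{L}_{n,k}$-free graph on $n$ vertices. Then $$ex(n,K_s,\mathcal{L}_{n,k})=\max\left\{\binom{k}{s},\ \binom{\lceil (k+1)/2\rceil}{s}+\Big(n-\Big\lceil \frac{k+1}{2}\Big\rceil\Big)\binom{\lfloor (k-1)/2\rfloor}{s-1}\right\}.$$ Moreover, write $K_m$ and $E_m$ for the complete and the empty graph on $m$ vertices, $\cup$ for disjoint union, and $G\vee H$ for the join of two disjoint graphs (their disjoint union together with all edges between them). The following $n$-vertex graphs are $\mathcal{L}_{n,k}$-free: the graph $K_k\cup E_{n-k}$, which contains exactly $\binom{k}{s}$ copies of $K_s$; and the graph $K_{(k-1)/2}\vee E_{n-(k-1)/2}$ if $k$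 is odd, or $K_{k/2-1}\vee(E_{n-k/2-1}\cup K_2)$ if $k$ is even, which contains exactly $\binom{\lceil (k+1)/2\rceil}{s}+\big(n-\lceil (k+1)/2\rceil\big)\binom{\lfloor (k-1)/2\rfloor}{s-1}$ copies of $K_s$. In particular, at least one of the two graphs attains the maximum. -/

import Mathlib

/-- A *linear forest*: every connected component is a path or an isolated vertex
(an isolated vertex being the path graph on one vertex). -/
def IsLinearForest {V : Type*} (F : SimpleGraph V) : Prop :=
  ∀ c : F.ConnectedComponent, ∃ m : ℕ, Nonempty (c.toSimpleGraph ≃g SimpleGraph.pathGraph m)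

/-- The family `𝓛_{n,k}` of all linear forests of order `n` with exactly `k` edges.
Every graph of order `n` is isomorphic to one on `Fin n`. -/
def linearForests (n k : ℕ) : Set (SimpleGraph (Fin n)) :=
  {F | IsLinearForest F ∧ F.edgeSet.ncard = k}

/-- `G` is `𝓕`-free: no member of the family is isomorphic to a
(not necessarily induced) subgraph of `G`. -/
def FamilyFree {V W : Type*} (𝓕 : Set (SimpleGraph W)) (G : SimpleGraph V) : Prop :=
  ∀ F ∈ 𝓕, F.Free G

/-- `ex(n, T, 𝓕) = N`: the maximum of the number of copies of `T` over all `𝓕`-free graphs on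
`n` vertices exists and equals `N`. Here `G.copyCount T` is the number of subgraphs of `G`
isomorphic to `T`. Stating the value as an attained maximum avoids a default value in the case
where no `𝓕`-free graph exists. -/
def IsGeneralizedTuranNumber {U W : Type*} (n : ℕ) (T : SimpleGraph U)
    (𝓕 : Set (SimpleGraph W)) (N : ℕ) : Prop :=
  IsGreatest {c : ℕ | ∃ G : SimpleGraph (Fin n), FamilyFree 𝓕 G ∧ G.copyCount T = c} N

/-- The join `G ∨ H` of two vertex-disjoint graphs: their disjoint union together with all edges
between the two vertex sets. -/
def graphJoin {V W : Type*} (G : SimpleGraph V) (H : SimpleGraph W) : SimpleGraph (V ⊕ W) :=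
  (G ⊕g H) ⊔ completeBipartiteGraph V W

/-- The graph `G` on a finite vertex type is an `n`-vertex `𝓕`-free graph with exactly `N` copies
of `T`. -/
def IsFreeWithCopies {V U W : Type*} [Fintype V] (n : ℕ) (T : SimpleGraph U)
    (𝓕 : Set (SimpleGraph W)) (G : SimpleGraph V) (N : ℕ) : Prop :=
  Fintype.card V = n ∧ FamilyFree 𝓕 G ∧ G.copyCount T = N

/-! Being `𝓛_{n,k}`-free is turned into a statement about orderings. If the vertices of an
`n`-vertex graph can be listed with at least `k` adjacent consecutive pairs, then `k` of these pairs
form a member of the family (`HasOrdering.not_familyFree`). For the upper bound it thus suffices to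
treat graphs without such an ordering.

Write `k + 1` for the number of edges. An edge-maximal graph without an ordering of value `k + 1`
has degree sum at most `k` on every non-adjacent pair, by a rotation-reversal exchange as in the
theorems of Ore and Bondy–Chvátal (`degree_add_degree_le_of_hasOrdering_sup_edge`). So the vertices
of degree above `k / 2` form a clique `A`, and `|A| ≤ k + 1` since a larger clique gives an
ordering. If `A` is small, it is enlarged to `k + 1 - k / 2` vertices, and all others have degree at
most `k / 2`. If `A` is large, each outside vertex misses some vertex of `A`, so its degree is at
most `b = k + 1 - |A|`. Deleting the outside vertices one at a time bounds the number of cliques by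
a convex function of `b`, whose endpoint values are the two terms of the maximum.

For the constructions, a linear forest supported on `k` vertices has fewer than `k` edges, and each
vertex of a cover accounts for at most two edges. -/

/-- The cliques of size `s` of `G` that are contained in `W`. -/
noncomputable def cliquesIn {V : Type*} (G : SimpleGraph V) (W : Finset V) (s : ℕ) :
    Finset (Finset V) :=
  open Classical in (W.powersetCard s).filter fun t ↦ G.IsClique (t : Set V)

/-! ### Counting cliques by deleting vertices -/

section CliqueCounting

variable {V : Type*} {G : SimpleGraph V}

theorem mem_cliquesIn {W t : Finset V} {s : ℕ} :
    t ∈ cliquesIn G W s ↔ (t ⊆ W ∧ t.card = s) ∧ G.IsClique (t : Set V) := by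
  simp [cliquesIn, Finset.mem_powersetCard]

theorem card_cliquesIn_le (W : Finset V) (s : ℕ) :
    (cliquesIn G W s).card ≤ W.card.choose s := by
  classical
  rw [← Finset.card_powersetCard]
  exact Finset.card_filter_le _ _

theorem card_cliquesIn_of_isClique {W : Finset V} (hW : G.IsClique (W : Set V)) (s : ℕ) :
    (cliquesIn G W s).card = W.card.choose s := by
  classical
  rw [← Finset.card_powersetCard]
  congr 1
  ext t
  rw [mem_cliquesIn, Finset.mem_powersetCard]
  exact ⟨fun h ↦ h.1, fun h ↦ ⟨h, hW.subset (by exact_mod_cast h.1)⟩⟩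

theorem card_cliquesIn_mono {H : SimpleGraph V} (h : G ≤ H) (W : Finset V) (s : ℕ) :
    (cliquesIn G W s).card ≤ (cliquesIn H W s).card := by
  refine Finset.card_le_card fun t ht ↦ ?_
  rw [mem_cliquesIn] at ht ⊢
  exact ⟨ht.1, ht.2.mono h⟩

-- Cliques avoiding `v` remain after its deletion; those containing `v` correspond to cliques in its
-- neighbourhood by removing `v`.
open Classical in
theorem card_cliquesIn_erase {W : Finset V} {v : V} (hv : v ∈ W) (s : ℕ) :
    (cliquesIn G W (s + 1)).card = (cliquesIn G (W.erase v) (s + 1)).card +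
      (cliquesIn G (W.filter (G.Adj v)) s).card := by
  have key : cliquesIn G W (s + 1) = cliquesIn G (W.erase v) (s + 1) ∪
      (cliquesIn G (W.filter (G.Adj v)) s).image (insert v) := by
    ext t
    simp only [Finset.mem_union, Finset.mem_image, mem_cliquesIn]
    constructor
    · rintro ⟨⟨htW, hts⟩, hc⟩
      by_cases hvt : v ∈ t
      · refine Or.inr ⟨t.erase v, ⟨⟨fun x hx ↦ ?_, ?_⟩, ?_⟩, Finset.insert_erase hvt⟩
        · rw [Finset.mem_erase] at hx
          exact Finset.mem_filter.2 ⟨htW hx.2, hc hvt hx.2 hx.1.symm⟩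
        · rw [Finset.card_erase_of_mem hvt, hts]; rfl
        · exact hc.subset (by simp)
      · exact Or.inl ⟨⟨Finset.subset_erase.2 ⟨htW, hvt⟩, hts⟩, hc⟩
    · rintro (⟨⟨htW, hts⟩, hc⟩ | ⟨t, ⟨⟨htW, hts⟩, hc⟩, rfl⟩)
      · exact ⟨⟨htW.trans (Finset.erase_subset _ _), hts⟩, hc⟩
      · have hvt : v ∉ t := fun h ↦ (Finset.mem_filter.1 (htW h)).2.ne rfl
        refine ⟨⟨Finset.insert_subset hv (htW.trans (Finset.filter_subset _ _)), ?_⟩, ?_⟩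
        · rw [Finset.card_insert_of_notMem hvt, hts]
        · rw [Finset.coe_insert]
          exact hc.insert fun x hx _ ↦ (Finset.mem_filter.1 (htW hx)).2
  have hnot : ∀ t ∈ cliquesIn G (W.filter (G.Adj v)) s, v ∉ t := fun t ht h ↦
    (Finset.mem_filter.1 ((mem_cliquesIn.1 ht).1.1 h)).2.ne rfl
  rw [key, Finset.card_union_of_disjoint, Finset.card_image_of_injOn]
  · intro t ht u hu h
    rw [← Finset.erase_insert (hnot t ht), ← Finset.erase_insert (hnot u hu)]
    exact congrArg (fun x ↦ Finset.erase x v) h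
  · rw [Finset.disjoint_left]
    intro t ht ht'
    obtain ⟨u, -, rfl⟩ := Finset.mem_image.1 ht'
    exact Finset.notMem_erase v W ((mem_cliquesIn.1 ht).1.1 (Finset.mem_insert_self v u))

open Classical in
/-- If every vertex outside `S` has at most `d` neighbours, removing these vertices one by one
bounds the number of cliques. -/
theorem card_cliquesIn_union_le {S : Finset V} {d : ℕ} (s : ℕ) (R : Finset V)
    (hR : Disjoint R S) (hd : ∀ v ∈ R, ((R ∪ S).filter (G.Adj v)).card ≤ d) :
    (cliquesIn G (R ∪ S) (s + 1)).card ≤ S.card.choose (s + 1) + R.card * d.choose s := by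
  induction R using Finset.induction_on with
  | empty => simpa using card_cliquesIn_le S (s + 1)
  | insert v R hv ih =>
    rw [Finset.disjoint_insert_left] at hR
    have hsub : R ∪ S ⊆ insert v R ∪ S :=
      Finset.union_subset_union_left (Finset.subset_insert v R)
    have h1 := ih hR.2 fun w hw ↦
      (Finset.card_le_card (Finset.filter_subset_filter _ hsub)).trans
        (hd w (Finset.mem_insert_of_mem hw))
    have h2 : (insert v R ∪ S).erase v = R ∪ S := by
      rw [Finset.insert_union, Finset.erase_insert (by simp [hv, hR.1])]
    rw [card_cliquesIn_erase (v := v) (by simp), h2, Finset.card_insert_of_notMem hv, add_mul,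
      one_mul, ← add_assoc]
    exact add_le_add h1 ((card_cliquesIn_le _ _).trans
      (Nat.choose_le_choose _ (hd v (Finset.mem_insert_self v R))))

open Classical in
/-- The number of cliques of a graph consisting of a clique `S` and further vertices all having
the same neighbourhood `T ⊆ S`. -/
theorem card_cliquesIn_union_eq {S T : Finset V} (hS : G.IsClique (S : Set V)) (hT : T ⊆ S)
    (s : ℕ) (R : Finset V) (hR : Disjoint R S)
    (hd : ∀ v ∈ R, ∀ w, G.Adj v w ↔ w ∈ T) :
    (cliquesIn G (R ∪ S) (s + 1)).card = S.card.choose (s + 1) + R.card * T.card.choose s := by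
  induction R using Finset.induction_on with
  | empty => simpa using card_cliquesIn_of_isClique hS (s + 1)
  | insert v R hv ih =>
    rw [Finset.disjoint_insert_left] at hR
    have h1 := ih hR.2 fun w hw ↦ hd w (Finset.mem_insert_of_mem hw)
    have h2 : (insert v R ∪ S).erase v = R ∪ S := by
      rw [Finset.insert_union, Finset.erase_insert (by simp [hv, hR.1])]
    have h3 : (insert v R ∪ S).filter (G.Adj v) = T := by
      ext w
      rw [Finset.mem_filter, hd v (Finset.mem_insert_self v R)]
      exact ⟨fun h ↦ h.2, fun h ↦ ⟨Finset.mem_union_right _ (hT h), h⟩⟩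
    rw [card_cliquesIn_erase (v := v) (by simp), h2, h3, h1, Finset.card_insert_of_notMem hv,
      card_cliquesIn_of_isClique (hS.subset (by exact_mod_cast hT))]
    ring

open Classical in
theorem card_cliquesIn_univ_le [Fintype V] {S : Finset V} {d : ℕ} (s : ℕ)
    (hd : ∀ v ∉ S, G.degree v ≤ d) :
    (cliquesIn G Finset.univ (s + 1)).card ≤
      S.card.choose (s + 1) + (Fintype.card V - S.card) * d.choose s := by
  have h := card_cliquesIn_union_le (G := G) (S := S) (d := d) s Sᶜ disjoint_compl_left
    fun v hv ↦ by
      refine le_trans (Finset.card_le_card fun w hw ↦ ?_) (hd v (Finset.mem_compl.1 hv))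
      exact (G.mem_neighborFinset v w).2 (Finset.mem_filter.1 hw).2
  rwa [Finset.union_comm, Finset.union_compl, Finset.card_compl] at h

theorem card_cliquesIn_univ_eq [Fintype V] {S T : Finset V} (hS : G.IsClique (S : Set V))
    (hT : T ⊆ S) (s : ℕ) (hd : ∀ v ∉ S, ∀ w, G.Adj v w ↔ w ∈ T) :
    (cliquesIn G Finset.univ (s + 1)).card =
      S.card.choose (s + 1) + (Fintype.card V - S.card) * T.card.choose s := by
  classical
  have h := card_cliquesIn_union_eq hS hT s Sᶜ disjoint_compl_left
    fun v hv ↦ hd v (Finset.mem_compl.1 hv)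
  rwa [Finset.union_comm, Finset.union_compl, Finset.card_compl] at h

/-- Copies of the complete graph on `s` vertices correspond to cliques of size `s`. -/
theorem copyCount_top_eq [Fintype V] (s : ℕ) :
    G.copyCount (⊤ : SimpleGraph (Fin s)) = (cliquesIn G Finset.univ s).card := by
  classical
  rw [SimpleGraph.copyCount]
  -- A copy of a complete graph is complete on its vertex set, hence determined by that set.
  have hadj : ∀ G' : G.Subgraph, Nonempty ((⊤ : SimpleGraph (Fin s)) ≃g G'.coe) →
      ∀ x ∈ G'.verts, ∀ y ∈ G'.verts, G'.Adj x y ↔ x ≠ y := by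
    rintro G' ⟨e⟩ x hx y hy
    have h := e.symm.map_adj_iff (v := ⟨x, hx⟩) (w := ⟨y, hy⟩)
    rw [SimpleGraph.top_adj, e.symm.injective.ne_iff] at h
    simpa using h.symm
  refine Finset.card_bij (fun G' _ ↦ G'.verts.toFinset) ?_ ?_ ?_
  · intro G' hG'
    have hG := (Finset.mem_filter.1 hG').2
    refine mem_cliquesIn.2 ⟨⟨Finset.subset_univ _, ?_⟩, ?_⟩
    · obtain ⟨e⟩ := hG
      rw [Set.toFinset_card, ← Fintype.card_congr e.toEquiv, Fintype.card_fin]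
    · intro x hx y hy hxy
      rw [Set.coe_toFinset] at hx hy
      exact G'.adj_sub ((hadj G' hG x hx y hy).2 hxy)
  · intro G₁ h₁ G₂ h₂ h
    have hv : G₁.verts = G₂.verts := Set.toFinset_inj.1 h
    have H₁ := hadj G₁ (Finset.mem_filter.1 h₁).2
    have H₂ := hadj G₂ (Finset.mem_filter.1 h₂).2
    refine SimpleGraph.Subgraph.ext hv ?_
    ext x y
    constructor <;> intro hxy
    · have hx := hxy.fst_mem
      have hy := hxy.snd_mem
      exact (H₂ x (hv ▸ hx) y (hv ▸ hy)).2 ((H₁ x hx y hy).1 hxy)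
    · have hx := hxy.fst_mem
      have hy := hxy.snd_mem
      exact (H₁ x (hv ▸ hx) y (hv ▸ hy)).2 ((H₂ x hx y hy).1 hxy)
  · intro t ht
    obtain ⟨⟨-, hts⟩, hc⟩ := mem_cliquesIn.1 ht
    let G' : G.Subgraph := (⊤ : G.Subgraph).induce (t : Set V)
    have e : Fin s ≃ (t : Set V) := (Fintype.equivFinOfCardEq (by simpa using hts)).symm
    refine ⟨G', Finset.mem_filter.2 ⟨Finset.mem_univ _, ⟨⟨e, ?_⟩⟩⟩, by simp [G']⟩
    intro a b
    have hab : (e a : V) ≠ e b ↔ a ≠ b := by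
      rw [Subtype.coe_injective.ne_iff, e.injective.ne_iff]
    rw [SimpleGraph.top_adj, ← hab]
    constructor
    · intro h
      exact (G'.adj_sub h).ne
    · intro h
      exact ⟨(e a).2, (e b).2, hc (e a).2 (e b).2 h⟩

end CliqueCounting

/-! ### Convexity of the bound -/

/-- A convex function on an initial segment of `ℕ` is bounded by its values at the end points. -/
theorem le_max_of_convex {f : ℕ → ℕ} {t : ℕ}
    (hf : ∀ b, b + 2 ≤ t → 2 * f (b + 1) ≤ f b + f (b + 2)) :
    ∀ b ≤ t, f b ≤ max (f 0) (f t) := by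
  induction t with
  | zero => intro b hb; simp [Nat.le_zero.1 hb]
  | succ t ih =>
    have ih := ih fun b hb ↦ hf b (by omega)
    intro b hb
    rcases hb.lt_or_eq with hb | rfl
    · have hmax : f t ≤ max (f 0) (f (t + 1)) := by
        rcases t with _ | t
        · exact le_max_left _ _
        · have h1 := ih t (by omega)
          have h2 : 2 * f (t + 1) ≤ f t + f (t + 1 + 1) := hf t (by omega)
          omega
      have := ih b (by omega)
      omega
    · exact le_max_right _ _

theorem two_mul_choose_succ_le (b s : ℕ) :
    2 * (b + 1).choose s ≤ b.choose s + (b + 2).choose s := by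
  rcases s with _ | s
  · simp
  · have h1 := Nat.choose_succ_succ' b s
    have h2 : (b + 2).choose (s + 1) = (b + 1).choose s + (b + 1).choose (s + 1) :=
      Nat.choose_succ_succ' (b + 1) s
    have h3 : b.choose s ≤ (b + 1).choose s := Nat.choose_le_choose s (by omega)
    omega

theorem choose_add_mul_choose_le_max {k t m s : ℕ} (htk : t ≤ k) (b : ℕ) (hb : b ≤ t) :
    (k - b).choose (s + 2) + (m + b) * b.choose (s + 1) ≤
      max (k.choose (s + 2)) ((k - t).choose (s + 2) + (m + t) * t.choose (s + 1)) := by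
  have h := le_max_of_convex (t := t)
    (f := fun b ↦ (k - b).choose (s + 2) + (m + b) * b.choose (s + 1)) ?_ b hb
  · simpa using h
  · intro b hb
    -- With `g b = b.choose (s + 1)`, the second difference of `(m + b) * g b` is `(m + b + 1)`
    -- times that of `g`, plus `g (b + 2) - g b`; both parts are nonnegative.
    have h1 := two_mul_choose_succ_le (k - (b + 2)) (s + 2)
    rw [show k - (b + 2) + 1 = k - (b + 1) by omega, show k - (b + 2) + 2 = k - b by omega] at h1
    have h2 := two_mul_choose_succ_le b (s + 1)
    have h3 : b.choose (s + 1) ≤ (b + 2).choose (s + 1) := Nat.choose_le_choose _ (by omega)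
    have h4 := Nat.mul_le_mul_left (m + b + 1) h2
    nlinarith

/-! ### Orderings and the degree-sum condition -/

open Classical in
/-- The number of pairs of consecutive entries of a list that are adjacent in `G`. -/
noncomputable def adjCount {V : Type*} (G : SimpleGraph V) : List V → ℕ
  | a :: b :: l => (if G.Adj a b then 1 else 0) + adjCount G (b :: l)
  | _ => 0

/-- The vertices of `G` can be listed such that at least `k` pairs of consecutive vertices are
adjacent. -/
def HasOrdering {V : Type*} (G : SimpleGraph V) (k : ℕ) : Prop :=
  ∃ l : List V, l.Nodup ∧ (∀ v, v ∈ l) ∧ k ≤ adjCount G l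

section Orderings

variable {V : Type*} {G H : SimpleGraph V}

@[simp] theorem adjCount_singleton (a : V) : adjCount G [a] = 0 := rfl

open Classical in
theorem adjCount_cons_cons (a b : V) (l : List V) :
    adjCount G (a :: b :: l) = (if G.Adj a b then 1 else 0) + adjCount G (b :: l) := rfl

open Classical in
theorem adjCount_append (p q : List V) (x y : V) :
    adjCount G (p ++ x :: y :: q) =
      adjCount G (p ++ [x]) + (if G.Adj x y then 1 else 0) + adjCount G (y :: q) := by
  induction p with
  | nil => simp [adjCount_cons_cons]
  | cons a p ih =>
    rcases p with _ | ⟨b, p⟩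
    · simp [adjCount_cons_cons, add_assoc]
    · simp only [List.cons_append, adjCount_cons_cons] at ih ⊢
      rw [ih]; ring

theorem adjCount_reverse (l : List V) : adjCount G l.reverse = adjCount G l := by
  classical
  induction l with
  | nil => rfl
  | cons a l ih =>
    rcases l with _ | ⟨b, l⟩
    · rfl
    · rw [adjCount_cons_cons, ← ih, List.reverse_cons, List.reverse_cons, List.append_assoc,
        List.singleton_append, adjCount_append, ← List.reverse_cons, ih, adjCount_singleton,
        add_zero, add_comm]
      simp only [G.adj_comm]

theorem adjCount_congr {l : List V} (h : ∀ a ∈ l, ∀ b ∈ l, G.Adj a b ↔ H.Adj a b) :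
    adjCount G l = adjCount H l := by
  classical
  induction l with
  | nil => rfl
  | cons a l ih =>
    rcases l with _ | ⟨b, l⟩
    · rfl
    · rw [adjCount_cons_cons, adjCount_cons_cons, h a (by simp) b (by simp),
        ih fun x hx y hy ↦ h x (by simp [hx]) y (by simp [hy])]

theorem exists_split_of_adjCount_lt {l : List V} (h : adjCount G l < adjCount H l) :
    ∃ p x y q, l = p ++ x :: y :: q ∧ H.Adj x y ∧ ¬ G.Adj x y := by
  classical
  induction l with
  | nil => exact absurd h (lt_irrefl _)
  | cons a l ih =>
    rcases l with _ | ⟨b, l⟩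
    · exact absurd h (lt_irrefl _)
    · by_cases hab : H.Adj a b ∧ ¬ G.Adj a b
      · exact ⟨[], a, b, l, rfl, hab⟩
      · obtain ⟨p, x, y, q, hl, hxy⟩ := ih (by
          rw [adjCount_cons_cons, adjCount_cons_cons] at h
          by_cases h1 : H.Adj a b <;> by_cases h2 : G.Adj a b <;> simp_all
          all_goals omega)
        exact ⟨a :: p, x, y, q, by rw [hl]; rfl, hxy⟩

theorem exists_split_of_adjCount_lt_length {l : List V} (h : adjCount G l + 1 < l.length) :
    ∃ p x y q, l = p ++ x :: y :: q ∧ ¬ G.Adj x y := by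
  classical
  induction l with
  | nil => simp at h
  | cons a l ih =>
    rcases l with _ | ⟨b, l⟩
    · simp at h
    · by_cases hab : G.Adj a b
      · obtain ⟨p, x, y, q, hl, hxy⟩ := ih (by
          rw [adjCount_cons_cons, if_pos hab, List.length_cons] at h
          omega)
        exact ⟨a :: p, x, y, q, by rw [hl]; rfl, hxy⟩
      · exact ⟨[], a, b, l, rfl, hab⟩

theorem length_le_adjCount_append {l : List V} (hl : l.Nodup)
    (hc : ∀ a ∈ l, ∀ b ∈ l, a ≠ b → G.Adj a b)
    (r : List V) : l.length ≤ adjCount G (l ++ r) + 1 := by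
  classical
  induction l with
  | nil => simp
  | cons a l ih =>
    rcases l with _ | ⟨b, l⟩
    · simp
    · have := ih hl.of_cons fun x hx y hy ↦ hc x (by simp [hx]) y (by simp [hy])
      have hab : G.Adj a b := hc a (by simp) b (by simp) (by
        rintro rfl; simp at hl)
      simp only [List.cons_append, adjCount_cons_cons, if_pos hab, List.length_cons] at this ⊢
      omega

-- Sums the hypothesis over all consecutive pairs: `dropLast` lists the left members, `tail` the
-- right ones. With `P` and `Q` as adjacency to the last and to the first entry, the left side
-- bounds the degree sum of the two ends.
open Classical in
theorem countP_add_countP_le_adjCount {P Q : V → Prop} {l : List V}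
    (h : ∀ p x y q, l = p ++ x :: y :: q →
      (if P x then 1 else 0) + (if Q y then 1 else 0) ≤ if G.Adj x y then 1 else 0) :
    l.dropLast.countP (fun x ↦ decide (P x)) + l.tail.countP (fun x ↦ decide (Q x)) ≤
      adjCount G l := by
  induction l with
  | nil => simp
  | cons a l ih =>
    rcases l with _ | ⟨b, l⟩
    · simp
    · have h1 := ih fun p x y q hl ↦ h (a :: p) x y q (by rw [hl]; rfl)
      have h2 := h [] a b l rfl
      simp only [List.tail_cons, List.dropLast_cons_cons, List.countP_cons, adjCount_cons_cons,
        decide_eq_true_eq] at h1 h2 ⊢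
      omega

theorem exists_cons_and_concat_of_eq_append {a b x y : V} {l p q : List V}
    (h : a :: (l ++ [b]) = p ++ x :: y :: q) :
    (∃ p', p ++ [x] = a :: p') ∧ ∃ q', y :: q = q' ++ [b] := by
  constructor
  · rcases p with _ | ⟨c, p⟩
    · simp only [List.nil_append, List.cons.injEq] at h
      exact ⟨[], by rw [h.1]; rfl⟩
    · simp only [List.cons_append, List.cons.injEq] at h
      exact ⟨p ++ [x], by rw [h.1]; rfl⟩
  · refine ⟨(y :: q).dropLast, ?_⟩
    replace h := congrArg List.getLast? h
    rw [← List.cons_append, List.getLast?_append_cons, List.getLast?_append_cons,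
      List.getLast?_cons_cons] at h
    exact (List.dropLast_append_getLast? b (l := y :: q) (by rw [← h]; simp)).symm

theorem adjCount_add_le_adjCount_append (p q : List V) :
    adjCount G p + adjCount G q ≤ adjCount G (p ++ q) := by
  classical
  induction p with
  | nil => simp [adjCount]
  | cons a p ih =>
    rcases p with _ | ⟨b, p⟩
    · rcases q with _ | ⟨c, q⟩
      · simp [adjCount]
      · simp [adjCount_cons_cons]
    · simp only [List.cons_append, adjCount_cons_cons] at ih ⊢
      omega

theorem length_eq_card_of_nodup_of_forall_mem [Fintype V] {l : List V} (hl : l.Nodup)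
    (hm : ∀ v, v ∈ l) : l.length = Fintype.card V := by
  classical
  rw [← List.toFinset_card_of_nodup hl, ← Finset.card_univ]
  congr 1
  ext w
  simpa only [List.mem_toFinset, Finset.mem_univ, iff_true] using hm w

theorem HasOrdering.of_perm {k : ℕ} {l m : List V} (hl : l.Nodup) (hm : ∀ v, v ∈ l)
    (hp : m.Perm l) (hk : k ≤ adjCount G m) : HasOrdering G k :=
  ⟨m, hp.nodup_iff.2 hl, fun v ↦ hp.mem_iff.2 (hm v), hk⟩

/-- If an ordering with `k` adjacent pairs has adjacent ends but is not a Hamiltonian path, it can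
be rotated to have `k + 1` adjacent pairs. -/
theorem HasOrdering.of_adj_ends {k : ℕ} {a b : V} {l : List V} (hl : (a :: (l ++ [b])).Nodup)
    (hm : ∀ v, v ∈ a :: (l ++ [b])) (hk : adjCount G (a :: (l ++ [b])) = k)
    (hlen : k ≤ l.length) (hab : G.Adj b a) : HasOrdering G (k + 1) := by
  classical
  -- There are `l.length + 1 > k` consecutive pairs, so one is non-adjacent. Cutting there and
  -- joining the old ends through the edge `b a` gains one pair.
  obtain ⟨p, x, y, q, hs, hxy⟩ := exists_split_of_adjCount_lt_length
    (l := a :: (l ++ [b])) (G := G) (by rw [hk]; simp; omega)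
  have hp : (y :: q ++ (p ++ [x])).Perm (a :: (l ++ [b])) := by
    rw [hs, List.append_cons p x (y :: q)]
    exact List.perm_append_comm
  refine HasOrdering.of_perm hl hm hp ?_
  obtain ⟨⟨p', hp'⟩, q', hq'⟩ := exists_cons_and_concat_of_eq_append hs
  rw [hs, adjCount_append, if_neg hxy, hp', hq'] at hk
  rw [hp', hq', List.append_assoc, List.singleton_append, adjCount_append, if_pos hab]
  omega

open Classical in
/-- The exchange argument: in a graph without an ordering with `k + 1` adjacent pairs, the end
vertices of an ordering with `k` adjacent pairs have degree sum at most `k`. -/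
theorem degree_add_degree_le_of_ends [Fintype V] {k : ℕ} {a b : V}
    {l : List V} (hG : ¬ HasOrdering G (k + 1)) (hl : (b :: (l ++ [a])).Nodup)
    (hm : ∀ v, v ∈ b :: (l ++ [a])) (hk : adjCount G (b :: (l ++ [a])) = k)
    (hlen : k ≤ l.length) : G.degree a + G.degree b ≤ k := by
  classical
  have hdeg : ∀ v, ∀ m : List V, m.Nodup → (∀ w, G.Adj v w → w ∈ m) →
      G.degree v ≤ m.countP (fun w ↦ decide (G.Adj v w)) := by
    intro v m hm hv
    rw [List.countP_eq_length_filter, ← List.toFinset_card_of_nodup (hm.filter _),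
      ← SimpleGraph.card_neighborFinset_eq_degree]
    refine Finset.card_le_card fun w hw ↦ ?_
    rw [SimpleGraph.mem_neighborFinset] at hw
    simp [hw, hv w hw]
  have hmain := countP_add_countP_le_adjCount (G := G) (P := G.Adj a) (Q := G.Adj b)
    (l := b :: (l ++ [a])) ?_
  · rw [hk] at hmain
    refine le_trans (add_le_add (hdeg a _ (hl.sublist (List.dropLast_sublist _)) ?_)
      (hdeg b _ (hl.sublist (List.tail_sublist _)) ?_)) hmain
    · intro w hw
      have := hm w
      rw [← List.cons_append, List.dropLast_concat]
      rw [← List.cons_append, List.mem_append] at this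
      exact this.resolve_right (by simpa using hw.ne')
    · intro w hw
      have := hm w
      rw [List.mem_cons] at this
      exact this.resolve_left hw.ne'
  · intro p x y q hs
    have hcount := hk
    rw [hs, adjCount_append] at hcount
    obtain ⟨⟨p', hp'⟩, q', hq'⟩ := exists_cons_and_concat_of_eq_append hs
    -- the end segment reversed: `b … x a … y`
    have c1 : adjCount G ((p ++ [x]) ++ (y :: q).reverse) =
        adjCount G (p ++ [x]) + (if G.Adj x a then 1 else 0) + adjCount G (y :: q) := by
      rw [← adjCount_reverse (y :: q), hq', List.reverse_append, List.reverse_singleton,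
        List.singleton_append, List.append_assoc, List.singleton_append, adjCount_append]
    -- the initial segment reversed: `x … b y … a`
    have c2 : adjCount G ((p ++ [x]).reverse ++ (y :: q)) =
        adjCount G (p ++ [x]) + (if G.Adj b y then 1 else 0) + adjCount G (y :: q) := by
      rw [← adjCount_reverse (p ++ [x]), hp', List.reverse_cons, List.append_assoc,
        List.singleton_append, adjCount_append]
    have hlist : b :: (l ++ [a]) = (p ++ [x]) ++ (y :: q) := by
      rw [hs, List.append_cons p x (y :: q)]
    have e1 : ((p ++ [x]) ++ (y :: q).reverse).Perm (b :: (l ++ [a])) := by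
      rw [hlist]; exact (List.reverse_perm _).append_left _
    have e2 : ((p ++ [x]).reverse ++ (y :: q)).Perm (b :: (l ++ [a])) := by
      rw [hlist]; exact (List.reverse_perm _).append_right _
    have f1 : adjCount G ((p ++ [x]) ++ (y :: q).reverse) < k + 1 := by
      by_contra h
      exact hG (HasOrdering.of_perm hl hm e1 (not_lt.1 h))
    have f2 : adjCount G ((p ++ [x]).reverse ++ (y :: q)) < k + 1 := by
      by_contra h
      exact hG (HasOrdering.of_perm hl hm e2 (not_lt.1 h))
    rw [c1] at f1
    rw [c2] at f2
    by_cases hxa : G.Adj x a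
    · by_cases hby : G.Adj b y
      -- Here `x y` is an edge, as otherwise reversing the end segment would gain a pair. The
      -- reversal `b … x a … y` then still has `k` pairs and its ends are adjacent, so it can be
      -- rotated to reach `k + 1`.
      · exfalso
        have hxy : G.Adj x y := by
          by_contra hxy
          rw [if_neg hxy] at hcount
          rw [if_pos hxa] at f1
          omega
        have hform : (p ++ [x]) ++ (y :: q).reverse = b :: ((p' ++ q.reverse) ++ [y]) := by
          rw [hp', List.reverse_cons]; simp
        rw [hform] at e1 c1
        rw [if_pos hxa] at c1
        rw [if_pos hxy] at hcount
        refine hG (HasOrdering.of_adj_ends (e1.nodup_iff.2 hl)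
          (fun v ↦ e1.mem_iff.2 (hm v)) (by omega) ?_ hby.symm)
        have := e1.length_eq
        simp at this ⊢
        omega
      · rw [if_pos hxa] at f1
        rw [if_neg hby, if_pos hxa.symm]
        omega
    · rw [if_neg (fun h ↦ hxa h.symm)]
      omega

open Classical in
/-- Non-adjacent vertices whose addition as an edge creates an ordering with `k + 1` adjacent
pairs have degree sum at most `k`. -/
theorem degree_add_degree_le_of_hasOrdering_sup_edge [Fintype V] {k : ℕ}
    {u v : V} (hn : k + 2 ≤ Fintype.card V) (hG : ¬ HasOrdering G (k + 1))
    (huv : HasOrdering (G ⊔ SimpleGraph.edge u v) (k + 1)) : G.degree u + G.degree v ≤ k := by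
  classical
  obtain ⟨l, hl, hm, hk⟩ := huv
  have hlt : adjCount G l < k + 1 := by
    by_contra h
    exact hG ⟨l, hl, hm, not_lt.1 h⟩
  obtain ⟨p, x, y, q, rfl, hadj, hnadj⟩ := exists_split_of_adjCount_lt (hlt.trans_le hk)
  have hxy : (u = x ∧ v = y) ∨ (u = y ∧ v = x) := by
    rw [SimpleGraph.sup_adj, SimpleGraph.edge_adj] at hadj
    grind
  have hnd : y ∉ p ++ [x] ∧ x ∉ y :: q := by
    rw [List.append_cons] at hl
    have := List.disjoint_of_nodup_append hl
    exact ⟨fun h ↦ this h (by simp), fun h ↦ this (by simp) h⟩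
  have hp : adjCount (G ⊔ SimpleGraph.edge u v) (p ++ [x]) = adjCount G (p ++ [x]) := by
    refine adjCount_congr fun a ha b hb ↦ ?_
    rw [SimpleGraph.sup_adj, SimpleGraph.edge_adj]
    grind
  have hq : adjCount (G ⊔ SimpleGraph.edge u v) (y :: q) = adjCount G (y :: q) := by
    refine adjCount_congr fun a ha b hb ↦ ?_
    rw [SimpleGraph.sup_adj, SimpleGraph.edge_adj]
    grind
  rw [adjCount_append, hp, hq, if_pos hadj] at hk
  -- The ordering uses the new edge only at the joint `x y`. Swapping the two pieces gives up this
  -- joint and leaves at least, hence exactly, `k` pairs of `G`, with `x` and `y` as the ends.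
  have hperm : (y :: ((q ++ p) ++ [x])).Perm (p ++ x :: y :: q) := by
    rw [List.append_cons p x]
    have : y :: ((q ++ p) ++ [x]) = (y :: q) ++ (p ++ [x]) := by simp
    rw [this]
    exact List.perm_append_comm
  have hle : adjCount G (p ++ [x]) + adjCount G (y :: q) ≤
      adjCount G (y :: ((q ++ p) ++ [x])) := by
    rw [show y :: ((q ++ p) ++ [x]) = (y :: q) ++ (p ++ [x]) by simp, add_comm]
    exact adjCount_add_le_adjCount_append _ _
  have hlt' : adjCount G (y :: ((q ++ p) ++ [x])) < k + 1 := by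
    by_contra h
    exact hG (HasOrdering.of_perm hl hm hperm (not_lt.1 h))
  have hcard := length_eq_card_of_nodup_of_forall_mem hl hm
  have := degree_add_degree_le_of_ends hG (hperm.nodup_iff.2 hl)
    (fun w ↦ hperm.mem_iff.2 (hm w)) (by omega) (by simp at hcard ⊢; omega)
  rcases hxy with ⟨rfl, rfl⟩ | ⟨rfl, rfl⟩ <;> omega

theorem HasOrdering.of_isClique [Fintype V] {A : Finset V} (hA : G.IsClique (A : Set V)) {k : ℕ}
    (hk : k + 1 ≤ A.card) : HasOrdering G k := by
  classical
  refine ⟨A.toList ++ Aᶜ.toList, ?_, fun v ↦ ?_, ?_⟩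
  · refine A.nodup_toList.append Aᶜ.nodup_toList fun v hv hv' ↦ ?_
    rw [Finset.mem_toList] at hv hv'
    exact Finset.mem_compl.1 hv' hv
  · simpa using em (v ∈ A)
  · have := length_le_adjCount_append (G := G) A.nodup_toList
      (fun a ha b hb hab ↦ hA (by simpa using ha) (by simpa using hb) hab) Aᶜ.toList
    rw [Finset.length_toList] at this
    omega

/-! ### The upper bound on cliques -/

/-- The upper bound for the number of cliques, for a graph whose non-adjacent vertices have degree
sum at most `k` and that has no ordering with `k + 1` adjacent pairs. -/
theorem card_cliquesIn_le_max_of_degree_sum [Fintype V] {k s : ℕ} (hn : k + 2 ≤ Fintype.card V)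
    (hG : ¬ HasOrdering G (k + 1)) [DecidableRel G.Adj]
    (hdeg : ∀ u v, u ≠ v → ¬ G.Adj u v → G.degree u + G.degree v ≤ k) :
    (cliquesIn G Finset.univ (s + 2)).card ≤ max ((k + 1).choose (s + 2))
      ((k + 1 - k / 2).choose (s + 2) +
        (Fintype.card V - (k + 1 - k / 2)) * (k / 2).choose (s + 1)) := by
  classical
  set A : Finset V := Finset.univ.filter fun v ↦ k / 2 < G.degree v with hAdef
  have hA : ∀ v, v ∈ A ↔ k / 2 < G.degree v := fun v ↦ by simp [hAdef]
  have hclique : G.IsClique (A : Set V) := by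
    intro u hu v hv huv
    by_contra h
    have h1 := hdeg u v huv h
    have h2 := (hA u).1 hu
    have h3 := (hA v).1 hv
    omega
  have hAk : A.card ≤ k + 1 := by
    by_contra h
    exact hG (HasOrdering.of_isClique hclique (by omega))
  rcases le_total A.card (k + 1 - k / 2) with hle | hge
  -- Small `A`: padding it to the size in the second term keeps every vertex of degree above `k / 2`
  -- inside `S`.
  · obtain ⟨S, hAS, hS⟩ := Finset.exists_superset_card_eq hle (by omega)
    refine le_trans ?_ (le_max_right _ _)
    rw [← hS]
    refine card_cliquesIn_univ_le (s + 1) fun v hv ↦ ?_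
    have := mt (@hAS v) hv
    rw [hA] at this
    have h4 : G.degree v ≤ k / 2 := not_lt.1 this
    convert h4
  · have h := card_cliquesIn_univ_le (G := G) (S := A) (d := k + 1 - A.card) (s + 1) fun v hv ↦ by
      -- A vertex adjacent to all of `A` has degree at least `k + 1 - k / 2 > k / 2`, so it would
      -- belong to `A`.
      obtain ⟨w, hw, hvw⟩ : ∃ w ∈ A, ¬ G.Adj v w := by
        by_contra! hall
        have h1 : A ⊆ G.neighborFinset v := fun w hw ↦ (G.mem_neighborFinset v w).2 (hall w hw)
        have h2 := Finset.card_le_card h1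
        rw [SimpleGraph.card_neighborFinset_eq_degree] at h2
        rw [hA] at hv
        omega
      have h1 := hdeg v w (by rintro rfl; exact hv hw) hvw
      have h2 : A.erase w ⊆ G.neighborFinset w := fun x hx ↦ by
        rw [Finset.mem_erase] at hx
        exact (G.mem_neighborFinset w x).2 (hclique hw hx.2 hx.1.symm)
      have h3 := Finset.card_le_card h2
      rw [SimpleGraph.card_neighborFinset_eq_degree, Finset.card_erase_of_mem hw] at h3
      have h4 : G.degree v ≤ k + 1 - A.card := by omega
      convert h4
    refine h.trans ?_
    -- The endpoint `b = 0` gives the first term, since `(0).choose (s + 1) = 0`; the endpoint `b =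
    -- k / 2` gives the second.
    have h1 := choose_add_mul_choose_le_max (k := k + 1) (t := k / 2)
      (m := Fintype.card V - (k + 1)) (s := s) (by omega) (k + 1 - A.card) (by omega)
    rw [show k + 1 - (k + 1 - A.card) = A.card by omega] at h1
    rw [show Fintype.card V - (k + 1) + (k + 1 - A.card) = Fintype.card V - A.card by omega,
      show Fintype.card V - (k + 1) + k / 2 = Fintype.card V - (k + 1 - k / 2) by omega] at h1
    exact h1

/-- Adding edges does not destroy cliques, so `G` may be replaced by an edge-maximal graph without
the ordering. There every missing edge would create one, which yields the degree-sum condition. -/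
theorem card_cliquesIn_le_max [Fintype V] {k s : ℕ} (hn : k + 2 ≤ Fintype.card V)
    (hG : ¬ HasOrdering G (k + 1)) :
    (cliquesIn G Finset.univ (s + 2)).card ≤ max ((k + 1).choose (s + 2))
      ((k + 1 - k / 2).choose (s + 2) +
        (Fintype.card V - (k + 1 - k / 2)) * (k / 2).choose (s + 1)) := by
  classical
  obtain ⟨M, hGM, hM⟩ := (Set.toFinite {H : SimpleGraph V |
    ¬ HasOrdering H (k + 1)}).exists_le_maximal hG
  refine (card_cliquesIn_mono hGM _ _).trans
    (card_cliquesIn_le_max_of_degree_sum hn hM.prop fun u v huv hnadj ↦ ?_)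
  have h := degree_add_degree_le_of_hasOrdering_sup_edge (u := u) (v := v) hn hM.prop (by
    by_contra h
    have h1 := hM.le_of_ge h le_sup_left
    exact hnadj (h1 (Or.inr ((SimpleGraph.edge_adj ..).2 ⟨Or.inl ⟨rfl, rfl⟩, huv⟩))))
  convert h

end Orderings

/-! ### Linear forests: orderings and edge bounds -/

section LinearForests

/-- Enumerating a component in increasing order identifies it with a path: connectedness forces
consecutive members to be adjacent. -/
theorem isLinearForest_of_le_pathGraph {n : ℕ} {F : SimpleGraph (Fin n)}
    (hF : F ≤ SimpleGraph.pathGraph n) : IsLinearForest F := by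
  classical
  intro c
  have hadj : ∀ {a b}, F.Adj a b → a.val + 1 = b.val ∨ b.val + 1 = a.val := fun h ↦
    SimpleGraph.pathGraph_adj.1 (hF h)
  let S : Finset (Fin n) := Finset.univ.filter (· ∈ c.supp)
  have hS : ∀ v, v ∈ S ↔ v ∈ c.supp := fun v ↦ by simp [S]
  let e := S.orderIsoOfFin rfl
  have hlt : ∀ {i j}, (e i : Fin n).val < (e j : Fin n).val ↔ i.val < j.val := fun {i j} ↦
    e.lt_iff_lt
  let f : Fin S.card ≃ c := ⟨fun i ↦ ⟨e i, (hS _).1 (e i).2⟩,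
    fun x ↦ e.symm ⟨x, (hS _).2 x.2⟩, fun i ↦ by simp, fun x ↦ by simp⟩
  have hf : ∀ i, ((f i : c) : Fin n) = (e i : Fin n) := fun i ↦ rfl
  have hAdj : ∀ x y : c, c.toSimpleGraph.Adj x y ↔ F.Adj x y := fun x y ↦ Iff.rfl
  have step : ∀ i j : Fin S.card, i.val + 1 = j.val → F.Adj (e i) (e j) := by
    intro i j hij
    -- A walk from `e i` to `e j` has an edge leaving the vertices up to `e i`. It lands at `e j` or
    -- beyond, and edges join consecutive numbers, so it is the edge from `e i` to `e j`.
    obtain ⟨w⟩ := c.connected_toSimpleGraph.preconnected (f i) (f j)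
    obtain ⟨⟨⟨x, y⟩, hxy⟩, -, h1, h2⟩ := w.exists_boundary_dart
      {x : c | (x : Fin n).val ≤ (e i : Fin n).val} (le_refl (e i : Fin n).val)
      (by rw [Set.mem_ofPred_eq, not_le, hf, hlt]; omega)
    obtain ⟨a, rfl⟩ := f.surjective x
    obtain ⟨b, rfl⟩ := f.surjective y
    simp only [Set.mem_ofPred_eq, hf, not_le] at h1 h2
    have h3 := hlt.1 h2
    rw [← not_lt, hlt] at h1
    have hab : F.Adj (e a) (e b) := (hAdj _ _).1 hxy
    have h4 : j.val ≤ b.val := by omega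
    have h5 : (e j : Fin n).val ≤ (e b : Fin n).val := by rw [← not_lt, hlt]; omega
    have h6 : (e i : Fin n).val < (e j : Fin n).val := hlt.2 (by omega)
    have h7 : (e a : Fin n).val ≤ (e i : Fin n).val := by rw [← not_lt, hlt]; omega
    have h8 := hadj hab
    have h9 : (e a : Fin n) = e i := Fin.ext (by omega)
    have h10 : (e b : Fin n) = e j := Fin.ext (by omega)
    rwa [h9, h10] at hab
  have step' : ∀ i j : Fin S.card, (e i : Fin n).val + 1 = (e j : Fin n).val →
      i.val + 1 = j.val := by
    intro i j hij
    have h1 : i.val < j.val := hlt.1 (by omega)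
    by_contra hne
    have h2 : i.val + 1 < S.card := by omega
    have h3 := (hlt (i := i) (j := ⟨i.val + 1, h2⟩)).2 (Nat.lt_succ_self _)
    have h4 := (hlt (i := ⟨i.val + 1, h2⟩) (j := j)).2 (by dsimp only; omega)
    omega
  refine ⟨S.card, ⟨RelIso.symm ⟨f, fun {i j} ↦ ?_⟩⟩⟩
  rw [SimpleGraph.pathGraph_adj, hAdj, hf, hf]
  constructor
  · intro h
    exact (hadj h).imp (step' i j) (step' j i)
  · rintro (h | h)
    · exact step i j h
    · exact (step j i h).symm

/-- A linear forest has a height function along its paths. -/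
theorem IsLinearForest.exists_height {V : Type*} {F : SimpleGraph V} (hF : IsLinearForest F) :
    ∃ h : V → ℕ, (∀ u v, F.Adj u v → h u + 1 = h v ∨ h v + 1 = h u) ∧
      ∀ u v w, F.Adj u v → F.Adj u w → h v = h w → v = w := by
  choose m e using hF
  let φ := fun c ↦ (e c).some
  let h : V → ℕ := fun v ↦ (φ (F.connectedComponentMk v) ⟨v, rfl⟩).val
  have hh : ∀ c (v : V) (hv : v ∈ c), h v = (φ c ⟨v, hv⟩).val := by
    rintro c v hv
    obtain rfl : F.connectedComponentMk v = c := hv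
    rfl
  refine ⟨h, fun u v huv ↦ ?_, fun u v w huv huw hvw ↦ ?_⟩
  · have hv : v ∈ F.connectedComponentMk u :=
      (SimpleGraph.ConnectedComponent.eq.2 huv.symm.reachable)
    rw [hh _ u rfl, hh _ v hv]
    have : (F.connectedComponentMk u).toSimpleGraph.Adj ⟨u, rfl⟩ ⟨v, hv⟩ := huv
    exact SimpleGraph.pathGraph_adj.1 ((φ _).map_adj_iff.2 this)
  · have hv : v ∈ F.connectedComponentMk u :=
      (SimpleGraph.ConnectedComponent.eq.2 huv.symm.reachable)
    have hw : w ∈ F.connectedComponentMk u :=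
      (SimpleGraph.ConnectedComponent.eq.2 huw.symm.reachable)
    rw [hh _ v hv, hh _ w hw] at hvw
    exact congrArg Subtype.val ((φ _).injective (Fin.ext hvw))

theorem IsLinearForest.ncard_neighborSet_le {V : Type*} [Finite V] {F : SimpleGraph V}
    (hF : IsLinearForest F) (v : V) : (F.neighborSet v).ncard ≤ 2 := by
  obtain ⟨h, h1, h2⟩ := hF.exists_height
  have hinj : Set.InjOn h (F.neighborSet v) := fun a ha b hb hab ↦ h2 v a b ha hb hab
  rw [← hinj.ncard_image]
  refine (Set.ncard_le_ncard (t := {h v - 1, h v + 1}) ?_).trans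
    ((Set.ncard_insert_le _ _).trans (by rw [Set.ncard_singleton]))
  rintro _ ⟨w, hw, rfl⟩
  have := h1 v w hw
  simp only [Set.mem_insert_iff, Set.mem_singleton_iff]
  omega

theorem IsLinearForest.ncard_edgeSet_le_of_cover {V : Type*} [Finite V] {F : SimpleGraph V}
    (hF : IsLinearForest F) (T : Finset V) (E : Set (Sym2 V))
    (hT : ∀ u v, F.Adj u v → u ∈ T ∨ v ∈ T ∨ s(u, v) ∈ E) :
    F.edgeSet.ncard ≤ T.card * 2 + E.ncard := by
  classical
  have hsub : F.edgeSet ⊆ (⋃ v ∈ T, (fun w ↦ s(v, w)) '' F.neighborSet v) ∪ E := by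
    intro x
    induction x with
    | _ u v =>
      intro huv
      rw [SimpleGraph.mem_edgeSet] at huv
      rcases hT u v huv with h | h | h
      · exact Or.inl (Set.mem_biUnion h ⟨v, huv, rfl⟩)
      · exact Or.inl (Set.mem_biUnion h ⟨u, huv.symm, Sym2.eq_swap⟩)
      · exact Or.inr h
  refine (Set.ncard_le_ncard hsub).trans ((Set.ncard_union_le _ _).trans ?_)
  refine Nat.add_le_add_right ((Finset.set_ncard_biUnion_le _ _).trans ?_) _
  refine Finset.sum_le_card_nsmul _ _ _ fun v _ ↦ ?_
  exact (Set.ncard_image_le).trans (hF.ncard_neighborSet_le v)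

/-- Each edge is determined by its higher end, and a non-isolated vertex of minimal height is never
a higher end. Without edges, the truncated subtraction is harmless. -/
theorem IsLinearForest.ncard_edgeSet_le_of_support {V : Type*} [Finite V] {F : SimpleGraph V}
    (hF : IsLinearForest F) (T : Finset V) (hT : ∀ u v, F.Adj u v → u ∈ T) :
    F.edgeSet.ncard ≤ T.card - 1 := by
  classical
  obtain ⟨h, h1, h2⟩ := hF.exists_height
  by_cases hE : F = ⊥
  · simp [hE]
  -- the vertices that are the higher end of some edge
  let U : Set V := {v | ∃ u, F.Adj u v ∧ h u + 1 = h v}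
  have hUE : F.edgeSet.ncard ≤ U.ncard := by
    have hlow : ∀ v ∈ U, ∃ u, F.Adj u v ∧ h u + 1 = h v := fun v hv ↦ hv
    choose! low hlow using hlow
    refine (Set.ncard_le_ncard (t := (fun v ↦ s(low v, v)) '' U) ?_).trans Set.ncard_image_le
    intro x
    induction x with
    | _ u v =>
      intro huv
      rw [SimpleGraph.mem_edgeSet] at huv
      have hmem : ∀ u v, F.Adj u v → h u + 1 = h v → s(u, v) ∈ (fun v ↦ s(low v, v)) '' U := by
        intro u v huv huv'
        have hv : v ∈ U := ⟨u, huv, huv'⟩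
        refine ⟨v, hv, ?_⟩
        have h3 := hlow v hv
        have h4 : low v = u := h2 v _ _ h3.1.symm huv.symm (by omega)
        simp only [h4]
      rcases h1 u v huv with h3 | h3
      · exact hmem u v huv h3
      · rw [Sym2.eq_swap]
        exact hmem v u huv.symm h3
  have hne : {u | ∃ v, F.Adj u v}.Nonempty := by
    obtain ⟨a, b, hab⟩ := SimpleGraph.ne_bot_iff_exists_adj.1 hE
    exact ⟨a, b, hab⟩
  obtain ⟨u, ⟨v, huv⟩, hmin⟩ := Set.exists_min_image _ h (Set.toFinite _) hne
  have huU : u ∉ U := by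
    rintro ⟨w, hw, hwu⟩
    have := hmin w ⟨u, hw⟩
    omega
  refine hUE.trans ?_
  rw [← Finset.card_erase_of_mem (hT u v huv), ← Set.ncard_coe_finset]
  refine Set.ncard_le_ncard ?_
  intro w hw
  rw [Finset.mem_coe, Finset.mem_erase]
  refine ⟨fun hwu ↦ huU (hwu ▸ hw), ?_⟩
  obtain ⟨x, hx, -⟩ := hw
  exact hT w x hx.symm

theorem exists_finset_card_eq_adjCount {V : Type*} (G : SimpleGraph V) (l : List V) :
    ∃ I : Finset ℕ, I.card = adjCount G l ∧
      ∀ i ∈ I, ∃ h : i + 1 < l.length, G.Adj l[i] l[i + 1] := by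
  classical
  induction l with
  | nil => exact ⟨∅, rfl, by simp⟩
  | cons a l ih =>
    rcases l with _ | ⟨b, l⟩
    · exact ⟨∅, rfl, by simp⟩
    · obtain ⟨I, hI, h⟩ := ih
      have hs : ∀ i ∈ I.map ⟨Nat.succ, Nat.succ_injective⟩,
          ∃ h : i + 1 < (a :: b :: l).length, G.Adj (a :: b :: l)[i] (a :: b :: l)[i + 1] := by
        intro i hi
        obtain ⟨j, hj, rfl⟩ := Finset.mem_map.1 hi
        obtain ⟨h1, h2⟩ := h j hj
        exact ⟨by simpa using h1, by simpa using h2⟩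
      by_cases hab : G.Adj a b
      · refine ⟨insert 0 (I.map ⟨Nat.succ, Nat.succ_injective⟩), ?_, ?_⟩
        · rw [Finset.card_insert_of_notMem (by simp), Finset.card_map, adjCount_cons_cons,
            if_pos hab, hI, add_comm]
        · intro i hi
          rcases Finset.mem_insert.1 hi with rfl | hi
          · exact ⟨by simp, by simpa using hab⟩
          · exact hs i hi
      · exact ⟨_, by rw [Finset.card_map, adjCount_cons_cons, if_neg hab, hI, zero_add], hs⟩

theorem HasOrdering.not_familyFree {n k : ℕ} {G : SimpleGraph (Fin n)} (h : HasOrdering G k) :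
    ¬ FamilyFree (linearForests n k) G := by
  classical
  obtain ⟨l, hl, hm, hk⟩ := h
  have hlen : l.length = n :=
    (length_eq_card_of_nodup_of_forall_mem hl hm).trans (Fintype.card_fin n)
  obtain ⟨I', hI', hadj'⟩ := exists_finset_card_eq_adjCount G l
  -- Members of the family have exactly `k` edges, so surplus positions are dropped.
  obtain ⟨I, hII', hI⟩ := Finset.exists_subset_card_eq (hk.trans_eq hI'.symm)
  have hadj := fun i hi ↦ hadj' i (hII' hi)
  have hlt : ∀ i ∈ I, i + 1 < n := fun i hi ↦ hlen ▸ (hadj i hi).1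
  let F : SimpleGraph (Fin n) :=
    { Adj := fun i j ↦ (i.val + 1 = j.val ∧ i.val ∈ I) ∨ (j.val + 1 = i.val ∧ j.val ∈ I)
      symm := ⟨fun i j h ↦ h.symm⟩
      loopless := ⟨fun i h ↦ by omega⟩ }
  have hF : F ∈ linearForests n k := by
    refine ⟨isLinearForest_of_le_pathGraph fun i j h ↦
      SimpleGraph.pathGraph_adj.2 (h.imp (fun h ↦ h.1) fun h ↦ h.1), ?_⟩
    rw [← hI, ← Set.ncard_coe_finset]
    symm
    refine Set.ncard_congr
      (fun i hi ↦ s((⟨i, (Nat.lt_succ_self i).trans (hlt i hi)⟩ : Fin n), ⟨i + 1, hlt i hi⟩))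
      (fun i hi ↦ Or.inl ⟨rfl, hi⟩) ?_ ?_
    · intro i j hi hj hij
      simp only [Sym2.eq_iff, Fin.mk.injEq] at hij
      omega
    · intro x
      induction x with
      | _ i j =>
        rintro (⟨h1, h2⟩ | ⟨h1, h2⟩)
        · exact ⟨i, h2, by simp [h1]⟩
        · refine ⟨j, h2, ?_⟩
          rw [Sym2.eq_swap]
          simp [h1]
  intro hfree
  have hpos : ∀ i : Fin n, i.val < l.length := fun i ↦ i.2.trans_eq hlen.symm
  have hmap : ∀ i j : Fin n, i.val + 1 = j.val → i.val ∈ I →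
      G.Adj (l[i.val]'(hpos i)) (l[j.val]'(hpos j)) := by
    intro i j hij hi
    obtain ⟨h1, h2⟩ := hadj i hi
    simpa only [hij] using h2
  refine hfree F hF ⟨⟨⟨fun i ↦ l[i.val]'(hpos i), ?_⟩, ?_⟩⟩
  · rintro i j (⟨h1, h2⟩ | ⟨h1, h2⟩)
    · exact hmap i j h1 h2
    · exact (hmap j i h1 h2).symm
  · intro i j hij
    exact Fin.ext ((List.Nodup.getElem_inj_iff hl).1 hij)

theorem familyFree_of_support {V : Type*} {n k : ℕ} (hk : 1 ≤ k) {G : SimpleGraph V}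
    (S : Finset V) (hS : ∀ u v, G.Adj u v → u ∈ S) (hcard : S.card ≤ k) :
    FamilyFree (linearForests n k) G := by
  classical
  rintro F ⟨hF, hFk⟩ ⟨f⟩
  have h := hF.ncard_edgeSet_le_of_support (Finset.univ.filter (f · ∈ S)) fun u v huv ↦
    Finset.mem_filter.2 ⟨Finset.mem_univ _, hS _ _ (f.toHom.map_adj huv)⟩
  have h2 : (Finset.univ.filter (f · ∈ S)).card ≤ S.card :=
    Finset.card_le_card_of_injOn f (fun x hx ↦ (Finset.mem_filter.1 hx).2) f.injective.injOn
  omega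

/-- In a copy of a linear forest each vertex of `T` meets at most two edges, and the remaining edges
lie in `E`. -/
theorem familyFree_of_cover {V : Type*} [Finite V] {n k : ℕ} {G : SimpleGraph V} (T : Finset V)
    (E : Set (Sym2 V)) (hT : ∀ u v, G.Adj u v → u ∈ T ∨ v ∈ T ∨ s(u, v) ∈ E)
    (hcard : T.card * 2 + E.ncard < k) : FamilyFree (linearForests n k) G := by
  classical
  rintro F ⟨hF, hFk⟩ ⟨f⟩
  have h := hF.ncard_edgeSet_le_of_cover (Finset.univ.filter (f · ∈ T)) (Sym2.map f ⁻¹' E)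
    fun u v huv ↦ by simpa using hT _ _ (f.toHom.map_adj huv)
  have h2 : (Finset.univ.filter (f · ∈ T)).card ≤ T.card :=
    Finset.card_le_card_of_injOn f (fun x hx ↦ (Finset.mem_filter.1 hx).2) f.injective.injOn
  have h3 : (Sym2.map f ⁻¹' E).ncard ≤ E.ncard :=
    Set.ncard_le_ncard_of_injOn (Sym2.map f) (fun _ hx ↦ hx)
      (Sym2.map.injective f.injective).injOn
  omega

end LinearForests

/-! ### Transport to `Fin n` and the extremal graphs -/

theorem FamilyFree.of_iso {V V' W : Type*} {𝓕 : Set (SimpleGraph W)} {G : SimpleGraph V}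
    {H : SimpleGraph V'} (h : FamilyFree 𝓕 G) (e : G ≃g H) : FamilyFree 𝓕 H :=
  fun F hF ↦ (SimpleGraph.free_congr_right e).1 (h F hF)

theorem card_cliquesIn_univ_le_of_embedding {V W : Type*} [Fintype V] [Fintype W]
    {G : SimpleGraph V} {H : SimpleGraph W} (e : G ↪g H) (s : ℕ) :
    (cliquesIn G Finset.univ s).card ≤ (cliquesIn H Finset.univ s).card := by
  refine Finset.card_le_card_of_injOn (fun t ↦ t.map e.toEmbedding) (fun t ht ↦ ?_)
    (Finset.map_injective _).injOn
  obtain ⟨⟨-, hts⟩, hc⟩ := mem_cliquesIn.1 ht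
  refine mem_cliquesIn.2 ⟨⟨Finset.subset_univ _, by rw [Finset.card_map, hts]⟩, ?_⟩
  rw [Finset.coe_map]
  rintro _ ⟨a, ha, rfl⟩ _ ⟨b, hb, rfl⟩ hab
  exact e.map_adj_iff.2 (hc ha hb fun h ↦ hab (congrArg _ h))

theorem IsFreeWithCopies.exists_fin {V W : Type*} [Fintype V] {n s N : ℕ}
    {𝓕 : Set (SimpleGraph W)} {G : SimpleGraph V}
    (h : IsFreeWithCopies n (⊤ : SimpleGraph (Fin s)) 𝓕 G N) :
    ∃ H : SimpleGraph (Fin n), FamilyFree 𝓕 H ∧ H.copyCount (⊤ : SimpleGraph (Fin s)) = N := by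
  obtain ⟨hn, hfree, hN⟩ := h
  refine ⟨G.overFin hn, hfree.of_iso (G.overFinIso hn), ?_⟩
  rw [← hN, copyCount_top_eq, copyCount_top_eq]
  exact le_antisymm (card_cliquesIn_univ_le_of_embedding (G.overFinIso hn).symm.toEmbedding s)
    (card_cliquesIn_univ_le_of_embedding (G.overFinIso hn).toEmbedding s)

theorem isFreeWithCopies_clique_sum_empty {n k : ℕ} (s : ℕ) (hk : 1 ≤ k) (hn : k ≤ n) :
    IsFreeWithCopies n (⊤ : SimpleGraph (Fin (s + 2))) (linearForests n k)
      ((⊤ : SimpleGraph (Fin k)) ⊕g (⊥ : SimpleGraph (Fin (n - k)))) (k.choose (s + 2)) := by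
  classical
  refine ⟨by simp; omega, familyFree_of_support hk (Finset.univ.map .inl) ?_ (by simp), ?_⟩
  · rintro (u | u) (v | v) h <;> simp at h ⊢
  · rw [copyCount_top_eq, card_cliquesIn_univ_eq (S := Finset.univ.map .inl) (T := ∅)]
    · simp
    · rintro (u | u) hu (v | v) hv huv <;> simp at hu hv huv ⊢; exact huv
    · simp
    · rintro (u | u) hu (v | v) <;> simp at hu ⊢

theorem graphJoin_adj {V W : Type*} {G : SimpleGraph V} {H : SimpleGraph W} (x y : V ⊕ W) :
    (graphJoin G H).Adj x y ↔ (G ⊕g H).Adj x y ∨ x.isLeft ∧ y.isRight ∨ x.isRight ∧ y.isLeft := by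
  simp [graphJoin]

theorem isFreeWithCopies_join_empty {n k t : ℕ} (s : ℕ) (hk : k = 2 * t + 1) (hn : k ≤ n) :
    IsFreeWithCopies n (⊤ : SimpleGraph (Fin (s + 2))) (linearForests n k)
      (graphJoin (⊤ : SimpleGraph (Fin t)) (⊥ : SimpleGraph (Fin (n - t))))
      ((t + 1).choose (s + 2) + (n - (t + 1)) * t.choose (s + 1)) := by
  classical
  refine ⟨by simp; omega, familyFree_of_cover (Finset.univ.map .inl) ∅ ?_ (by simp; omega), ?_⟩
  · rintro (u | u) (v | v) h <;> simp [graphJoin_adj] at h ⊢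
  · let x : Fin (n - t) := ⟨0, by omega⟩
    -- One vertex `x` of the empty part joins the clique; every other vertex has exactly the `t`
    -- clique vertices as neighbours.
    rw [copyCount_top_eq, card_cliquesIn_univ_eq (S := insert (Sum.inr x) (Finset.univ.map .inl))
      (T := Finset.univ.map .inl)]
    · rw [Finset.card_insert_of_notMem (by simp)]
      simp only [Finset.card_map, Finset.card_univ, Fintype.card_fin, Fintype.card_sum]
      rw [Nat.add_sub_of_le (by omega)]
    · rintro (u | u) hu (v | v) hv huv <;> simp [graphJoin_adj] at hu hv huv ⊢
      · exact huv
      · exact huv (hu.trans hv.symm)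
    · exact Finset.subset_insert _ _
    · rintro (u | u) hu (v | v) <;> simp [graphJoin_adj] at hu ⊢

theorem isFreeWithCopies_join_edge {n k t : ℕ} (s : ℕ) (hk : k = 2 * t + 2) (hn : k ≤ n) :
    IsFreeWithCopies n (⊤ : SimpleGraph (Fin (s + 2))) (linearForests n k)
      (graphJoin (⊤ : SimpleGraph (Fin t))
        ((⊥ : SimpleGraph (Fin (n - (t + 1) - 1))) ⊕g (⊤ : SimpleGraph (Fin 2))))
      ((t + 2).choose (s + 2) + (n - (t + 2)) * t.choose (s + 1)) := by
  classical
  refine ⟨by simp; omega, familyFree_of_cover (Finset.univ.map .inl)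
    {s(.inr (.inr 0), .inr (.inr 1))} ?_ (by simp; omega), ?_⟩
  · rintro (u | u | u) (v | v | v) h <;> simp [graphJoin_adj] at h ⊢
    omega
  -- Both ends of the extra edge join the clique, which then has `t + 2` vertices.
  · rw [copyCount_top_eq, card_cliquesIn_univ_eq
      (S := Finset.univ.map .inl ∪ (Finset.univ.map .inr).map .inr)
      (T := Finset.univ.map .inl)]
    · rw [Finset.card_union_of_disjoint (by simp [Finset.disjoint_left])]
      simp only [Finset.card_map, Finset.card_univ, Fintype.card_fin, Fintype.card_sum]
      rw [show t + (n - (t + 1) - 1 + 2) = n by omega]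
    · rintro (u | u | u) hu (v | v | v) hv huv <;> simp [graphJoin_adj] at hu hv huv ⊢
      · exact huv
      · exact huv
    · exact Finset.subset_union_left
    · rintro (u | u | u) hu (v | v | v) <;> simp [graphJoin_adj] at hu ⊢
      omega

/-! ### The main theorem -/

theorem theorem1p5 (n k s : ℕ) (hs : 2 ≤ s) (hk : 1 ≤ k) (hn : k + 1 ≤ n) :
    -- the value of the generalized Turan number
    IsGeneralizedTuranNumber n (⊤ : SimpleGraph (Fin s)) (linearForests n k)
      (max (k.choose s)
        (((k + 1) ⌈/⌉ 2).choose s + (n - (k + 1) ⌈/⌉ 2) * ((k - 1) / 2).choose (s - 1))) ∧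
    -- the clique on `k` vertices, with isolated vertices added, realizes the first term
    IsFreeWithCopies n (⊤ : SimpleGraph (Fin s)) (linearForests n k)
      ((⊤ : SimpleGraph (Fin k)) ⊕g (⊥ : SimpleGraph (Fin (n - k)))) (k.choose s) ∧
    -- for odd `k`, the join of a clique and an empty graph realizes the second term
    (Odd k →
      IsFreeWithCopies n (⊤ : SimpleGraph (Fin s)) (linearForests n k)
        (graphJoin (⊤ : SimpleGraph (Fin ((k - 1) / 2)))
          (⊥ : SimpleGraph (Fin (n - (k - 1) / 2))))
        (((k + 1) ⌈/⌉ 2).choose s + (n - (k + 1) ⌈/⌉ 2) * ((k - 1) / 2).choose (s - 1))) ∧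
    -- for even `k`, the analogue with one extra edge realizes the second term
    (Even k →
      IsFreeWithCopies n (⊤ : SimpleGraph (Fin s)) (linearForests n k)
        (graphJoin (⊤ : SimpleGraph (Fin (k / 2 - 1)))
          ((⊥ : SimpleGraph (Fin (n - k / 2 - 1))) ⊕g (⊤ : SimpleGraph (Fin 2))))
        (((k + 1) ⌈/⌉ 2).choose s + (n - (k + 1) ⌈/⌉ 2) * ((k - 1) / 2).choose (s - 1))) := by
  obtain ⟨s, rfl⟩ := Nat.exists_eq_add_of_le' hs
  have hclique := isFreeWithCopies_clique_sum_empty s hk (by omega : k ≤ n)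
  have hceil : (k + 1) ⌈/⌉ 2 = (k + 2) / 2 := rfl
  have hodd : Odd k → IsFreeWithCopies n (⊤ : SimpleGraph (Fin (s + 2))) (linearForests n k)
        (graphJoin (⊤ : SimpleGraph (Fin ((k - 1) / 2)))
          (⊥ : SimpleGraph (Fin (n - (k - 1) / 2))))
        (((k + 1) ⌈/⌉ 2).choose (s + 2) +
          (n - (k + 1) ⌈/⌉ 2) * ((k - 1) / 2).choose (s + 2 - 1)) := by
    rintro ⟨t, ht⟩
    rw [hceil, show (k + 2) / 2 = t + 1 by omega, show (k - 1) / 2 = t by omega]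
    exact isFreeWithCopies_join_empty s ht (by omega)
  have heven : Even k → IsFreeWithCopies n (⊤ : SimpleGraph (Fin (s + 2))) (linearForests n k)
        (graphJoin (⊤ : SimpleGraph (Fin (k / 2 - 1)))
          ((⊥ : SimpleGraph (Fin (n - k / 2 - 1))) ⊕g (⊤ : SimpleGraph (Fin 2))))
        (((k + 1) ⌈/⌉ 2).choose (s + 2) +
          (n - (k + 1) ⌈/⌉ 2) * ((k - 1) / 2).choose (s + 2 - 1)) := by
    rintro ⟨t, ht⟩
    obtain ⟨t, rfl⟩ := Nat.exists_eq_add_of_le' (by omega : 1 ≤ t)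
    rw [hceil, show (k + 2) / 2 = t + 2 by omega, show (k - 1) / 2 = t by omega,
      show k / 2 = t + 1 by omega]
    exact isFreeWithCopies_join_edge s (by omega) (by omega)
  refine ⟨⟨?_, ?_⟩, hclique, hodd, heven⟩
  · rcases max_choice (k.choose (s + 2)) (((k + 1) ⌈/⌉ 2).choose (s + 2) +
      (n - (k + 1) ⌈/⌉ 2) * ((k - 1) / 2).choose (s + 2 - 1)) with h | h <;> rw [h]
    · exact hclique.exists_fin
    · rcases Nat.even_or_odd k with hk | hk
      · exact (heven hk).exists_fin
      · exact (hodd hk).exists_fin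
  · rintro _ ⟨G, hG, rfl⟩
    -- The upper bound is stated for `k + 1` edges; after the shift, `k + 1 - k / 2` is the
    -- rounded-up half and `k / 2` the rounded-down one.
    obtain ⟨k, rfl⟩ := Nat.exists_eq_add_of_le' hk
    rw [copyCount_top_eq, hceil, show (k + 1 + 2) / 2 = k + 1 - k / 2 by omega]
    have h := card_cliquesIn_le_max (G := G) (k := k) (s := s) (by rw [Fintype.card_fin]; omega)
      fun h ↦ h.not_familyFree hG
    rwa [Fintype.card_fin] at h
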